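/- **Setting.** Let $\mathcal M=(\mathcal X,\mathcal A,r,P,\gamma,\nu_0)$ be a discounted MDP with finite state space $\mathcal X$, finite action space $\mathcal A$, reward $r:\mathcal X\times\mathcal A\to[0,1]$, transition probabilities $P(\cdot\mid x,a)$ on $\mathcal X$, discount factor $\gamma\in(0,1)$ and initial distribution $\nu_0$; write $H=\frac1{1-\gamma}$, and $\|v\|_Z=\sqrt{\langle v,Zv\rangle}$. Suppose that $\mathcal M$ is a *linear mixture MDP*: for a known feature map $\psi:\mathcal X\times\mathcal A\times\mathcal X\to\mathbb R^d$ there is an (unknown) $\theta\in\mathbb R^d$ with $\|\theta\|_2\le B$ and $P(x'\mid x,a)=\sum_{i=1}^d\theta_i\psi_i(x,a,x')$ for all $x,a,x'$, and $\big\|\sum_{x'}\psi(x,a,x')V(x')\big\|_2\le BH$ for all $(x,a)$ and all $V\in[0,H]^{\mathcal X}$. **Algorithm (RAVI-UCB for linear mixture MDPs).** The inputs are a horizon $T$, $\eta>0$, $\lambda>0$, $\beta$, an initial value $V_0\in[0,H]^{\mathcal X}$ (for example $V_0=0$) and an initial policy $\pi_0$. Put $\Lambda_1=\lambda I$, $b_1=0$,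 $Q_1(x,a)=V_0(x)$, $T_1=1$, and draw $x_1\sim\nu_0$. At the start of epoch $k$, at time $T_k$, put $$\widehat\theta_k=\Lambda_{T_k}^{-1}b_{T_k},\qquad \widehat P_k(x'\mid x,a)=\sum_{i=1}^d\widehat\theta_{k,i}\,\psi_i(x,a,x'),$$ $$V_k(x)=\tfrac1\eta\log\sum_a\pi_{k-1}(a\mid x)e^{\eta Q_k(x,a)},\qquad \pi_k(a\mid x)=\pi_{k-1}(a\mid x)e^{\eta(Q_k(x,a)-V_k(x))},$$ $$\phi_k(x,a)=\sum_{x'}\psi(x,a,x')V_k(x'),\qquad \mathrm{CB}_k(x,a)=\beta\,\|\phi_k(x,a)\|_{\Lambda_{T_k}^{-1}},$$ $$Q_{k+1}(x,a)=\max\Big\{\min\Big[r(x,a)+\mathrm{CB}_k(x,a)+\gamma\sum_{x'}\widehat P_k(x'\mid x,a)V_k(x'),\,H\Big],\,0\Big\}.$$ In each round $t$ of epoch $k$, the action $a_t\sim\pi_k(\cdot\mid x_t)$ is played, the next state $x'_{t+1}\sim P(\cdot\mid x_t,a_t)$ is observed, and $$\Lambda_{t+1}=\Lambda_t+\phi_k(x_t,a_t)\phi_k(x_t,a_t)^{\mathsf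 T},\qquad b_{t+1}=b_t+\phi_k(x_t,a_t)V_k(x'_{t+1}).$$ Then, independently with probability $1-\gamma$, the environment is reset: $x_{t+1}\sim\nu_0$ and epoch $k+1$ starts at time $T_{k+1}=t+1$; otherwise $x_{t+1}=x'_{t+1}$ and epoch $k$ continues. **Lemma.** Let $\delta\in(0,1)$, and let the algorithm be run for $T$ rounds with $$\beta=H\sqrt{2\Big(\frac d2\log\Big[1+\frac{TB^2H^2}{\lambda d}\Big]+\log\frac1\delta\Big)}+\sqrt\lambda\,B.$$ Then with probability at least $1-\delta$ the bonuses are valid in every epoch, that is, $$\Big|\sum_{x'}\big(\gamma P(x'\mid x,a)-\gamma\widehat P_k(x'\mid x,a)\big)V_k(x')\Big|\le\mathrm{CB}_k(x,a)$$ holds simultaneously for all $(x,a)\in\mathcal X\times\mathcal A$ and all epochs $k$ with $T_k\le T$. -/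

import Mathlib

open scoped ENNReal

noncomputable section

namespace RaviUCB

/-- A finite discounted Markov decision process with known deterministic reward in `[0, 1]`. -/
structure MDP (X A : Type*) where
  /-- transition probabilities `P(· | x, a)` -/
  P : X → A → PMF X
  /-- reward function -/
  r : X → A → ℝ
  r_nonneg : ∀ x a, 0 ≤ r x a
  r_le_one : ∀ x a, r x a ≤ 1
  /-- discount factor -/
  γ : ℝ
  γ_pos : 0 < γ
  γ_lt_one : γ < 1
  /-- initial state distribution -/
  ν₀ : PMF X

/-- The effective horizon `H = 1 / (1 - γ)`. -/
def MDP.H {X A : Type*} (M : MDP X A) : ℝ := 1 / (1 - M.γ)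

/-- The Euclidean norm of a vector of `ℝ^d`. -/
def l2norm {d : ℕ} (v : Fin d → ℝ) : ℝ := ‖WithLp.toLp 2 v‖

/-- `‖v‖_Z = √⟨v, Z v⟩`. -/
def matNorm {d : ℕ} (Z : Matrix (Fin d) (Fin d) ℝ) (v : Fin d → ℝ) : ℝ :=
  Real.sqrt (v ⬝ᵥ Z.mulVec v)

/-- `φ_V(x, a) = ∑_{x'} ψ(x, a, x') V(x')`. -/
def feature {X A : Type*} [Fintype X] {d : ℕ} (ψ : X → A → X → Fin d → ℝ)
    (V : X → ℝ) (x : X) (a : A) : Fin d → ℝ :=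
  ∑ x', V x' • ψ x a x'

/-- `M` is a linear mixture MDP with feature map `ψ` and norm bound `B`. -/
def IsLinearMixture {X A : Type*} [Fintype X] {d : ℕ} (M : MDP X A)
    (ψ : X → A → X → Fin d → ℝ) (B : ℝ) : Prop :=
  (∃ θ : Fin d → ℝ, l2norm θ ≤ B ∧
    ∀ x a x', (M.P x a x').toReal = ∑ i, θ i * ψ x a x' i) ∧
  ∀ x a, ∀ V : X → ℝ, (∀ y, 0 ≤ V y ∧ V y ≤ M.H) → l2norm (feature ψ V x a) ≤ B * M.H

/-- Validity of an exploration bonus `CB` for a model estimate `Phat` and a value function `V`: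
`|⟨γ P(· | x, a) - γ Phat(· | x, a), V⟩| ≤ CB(x, a)` for all `x, a`. -/
def IsValidBonus {X A : Type*} [Fintype X] (M : MDP X A) (Phat : X → A → X → ℝ) (V : X → ℝ)
    (CB : X → A → ℝ) : Prop :=
  ∀ x a, |∑ x', (M.γ * (M.P x a x').toReal - M.γ * Phat x a x') * V x'| ≤ CB x a

/-- Truncation of a real number to `[0, m]`. -/
def trunc (m y : ℝ) : ℝ := max (min y m) 0

/-- The softmax value `(1/η) log ∑_a π(a) exp(η q(a))`. -/
def softValue {A : Type*} [Fintype A] (η : ℝ) (π : PMF A) (q : A → ℝ) : ℝ :=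
  1 / η * Real.log (∑ a, (π a).toReal * Real.exp (η * q a))

theorem sum_toReal_pmf {A : Type*} [Fintype A] (π : PMF A) : ∑ a, (π a).toReal = 1 := by
  have h := π.tsum_coe
  rw [tsum_fintype] at h
  rw [← ENNReal.toReal_sum (fun a _ => π.apply_ne_top a), h, ENNReal.toReal_one]

theorem sum_exp_pos {A : Type*} [Fintype A] (η : ℝ) (π : PMF A) (q : A → ℝ) :
    0 < ∑ a, (π a).toReal * Real.exp (η * q a) := by
  have h0 : ∀ a ∈ Finset.univ, 0 ≤ (π a).toReal * Real.exp (η * q a) := fun a _ => by positivity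
  refine lt_of_le_of_ne (Finset.sum_nonneg h0) (fun h => ?_)
  have h1 := (Finset.sum_eq_zero_iff_of_nonneg h0).1 h.symm
  have h2 : ∑ a, (π a).toReal = 0 := Finset.sum_eq_zero fun a ha => by
    have := h1 a ha
    simpa [Real.exp_ne_zero] using this
  rw [sum_toReal_pmf] at h2
  exact one_ne_zero h2

theorem sum_softmax_eq_one {A : Type*} [Fintype A] {η : ℝ} (hη : 0 < η) (π : PMF A)
    (q : A → ℝ) :
    ∑ a, ENNReal.ofReal ((π a).toReal * Real.exp (η * (q a - softValue η π q))) = 1 := by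
  rw [← ENNReal.ofReal_sum_of_nonneg (fun a _ => by positivity)]
  have hS := sum_exp_pos η π q
  have key : ∀ a, (π a).toReal * Real.exp (η * (q a - softValue η π q)) =
      ((π a).toReal * Real.exp (η * q a)) / ∑ a, (π a).toReal * Real.exp (η * q a) := by
    intro a
    have : η * (q a - softValue η π q) =
        η * q a - Real.log (∑ a, (π a).toReal * Real.exp (η * q a)) := by
      unfold softValue
      field_simp
    rw [this, Real.exp_sub, Real.exp_log hS, mul_div_assoc]
  simp_rw [key]
  rw [← Finset.sum_div, div_self hS.ne', ENNReal.ofReal_one]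

/-- The softmax update `a ↦ π(a) exp(η (q(a) - V))`, where `V` is the softmax value. -/
def softPolicy {A : Type*} [Fintype A] {η : ℝ} (hη : 0 < η) (π : PMF A) (q : A → ℝ) : PMF A :=
  PMF.ofFintype
    (fun a => ENNReal.ofReal ((π a).toReal * Real.exp (η * (q a - softValue η π q))))
    (sum_softmax_eq_one hη π q)

/-- The inputs of the algorithm. -/
structure Inputs (X A : Type*) where
  /-- learning rate -/
  η : ℝ
  η_pos : 0 < η
  /-- regularization parameter -/
  lam : ℝ
  lam_pos : 0 < lam
  /-- scaling coefficient of the exploration bonuses -/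
  β : ℝ
  /-- initial value -/
  V₀ : X → ℝ
  /-- initial policy -/
  π₀ : X → PMF A

/-- What the algorithm holds when epoch `k` starts; all other quantities of the epoch are
computed from these. -/
structure Epoch (X A : Type*) (d : ℕ) where
  /-- the index `k` -/
  idx : ℕ
  /-- the first time index `T_k` -/
  start : ℕ
  /-- `Λ_{T_k}` -/
  Λ : Matrix (Fin d) (Fin d) ℝ
  /-- `b_{T_k}` -/
  b : Fin d → ℝ
  /-- `Q_k` -/
  Q : X → A → ℝ
  /-- `π_{k-1}` -/
  prevPolicy : X → PMF A

namespace Epoch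

variable {X A : Type*} [Fintype X] [Fintype A] {d : ℕ}

/-- The least-squares estimate `θ̂_k = Λ_{T_k}⁻¹ b_{T_k}`. -/
def thetaHat (e : Epoch X A d) : Fin d → ℝ := (e.Λ⁻¹).mulVec e.b

/-- `P̂_k = ∑_i θ̂_{k,i} ψ_i`. -/
def PHat (ψ : X → A → X → Fin d → ℝ) (e : Epoch X A d) (x : X) (a : A) (x' : X) : ℝ :=
  ∑ i, e.thetaHat i * ψ x a x' i

/-- `V_k`. -/
def V (I : Inputs X A) (e : Epoch X A d) (x : X) : ℝ := softValue I.η (e.prevPolicy x) (e.Q x)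

/-- `π_k`. -/
def policy (I : Inputs X A) (e : Epoch X A d) (x : X) : PMF A :=
  softPolicy I.η_pos (e.prevPolicy x) (e.Q x)

/-- `φ_k`. -/
def φ (ψ : X → A → X → Fin d → ℝ) (I : Inputs X A) (e : Epoch X A d) (x : X) (a : A) :
    Fin d → ℝ :=
  feature ψ (e.V I) x a

/-- The elliptical bonus `CB_k(x, a) = β ‖φ_k(x, a)‖_{Λ_{T_k}⁻¹}`. -/
def CB (ψ : X → A → X → Fin d → ℝ) (I : Inputs X A) (e : Epoch X A d) (x : X) (a : A) : ℝ :=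
  I.β * matNorm e.Λ⁻¹ (e.φ ψ I x a)

/-- `Q_{k+1} = Π_H [r + CB_k + γ P̂_k V_k]`. -/
def nextQ (M : MDP X A) (ψ : X → A → X → Fin d → ℝ) (I : Inputs X A) (e : Epoch X A d)
    (x : X) (a : A) : ℝ :=
  trunc M.H (M.r x a + e.CB ψ I x a + M.γ * ∑ x', e.PHat ψ x a x' * e.V I x')

/-- The bonus `CB_k` of the epoch is valid. -/
def Valid (M : MDP X A) (ψ : X → A → X → Fin d → ℝ) (I : Inputs X A) (e : Epoch X A d) : Prop :=
  IsValidBonus M (e.PHat ψ) (e.V I) (e.CB ψ I)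

end Epoch

/-- The state of the interaction just before round `t` is played. -/
structure RunState (X A : Type*) (d : ℕ) where
  /-- the time index `t` -/
  t : ℕ
  /-- the environment state `x_t` -/
  x : X
  /-- `Λ_t` -/
  Λ : Matrix (Fin d) (Fin d) ℝ
  /-- `b_t` -/
  b : Fin d → ℝ
  /-- the current epoch -/
  cur : Epoch X A d
  /-- the epochs that have ended, latest first -/
  past : List (Epoch X A d)

instance (X A : Type*) (d : ℕ) : MeasurableSpace (RunState X A d) := ⊤

/-- All epochs that have been started. -/
def RunState.epochs {X A : Type*} {d : ℕ} (s : RunState X A d) : List (Epoch X A d) :=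
  s.cur :: s.past

/-- The reset coin: `true` with probability `1 - γ`, `false` with probability `γ`. -/
def MDP.resetCoin {X A : Type*} (M : MDP X A) : PMF Bool :=
  PMF.ofFintype (fun c => if c then ENNReal.ofReal (1 - M.γ) else ENNReal.ofReal M.γ) (by
    simp only [Fintype.sum_bool, if_true, Bool.false_eq_true, if_false]
    rw [← ENNReal.ofReal_add (by linarith [M.γ_lt_one]) M.γ_pos.le]
    simp)

section Run

variable {X A : Type*} [Fintype X] [Fintype A] {d : ℕ}

/-- The state before round `1`, when the environment is in state `x`:
`Λ_1 = λ I`, `b_1 = 0`, `Q_1 = E V_0`. -/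
def initState (I : Inputs X A) (x : X) : RunState X A d where
  t := 1
  x := x
  Λ := I.lam • (1 : Matrix (Fin d) (Fin d) ℝ)
  b := 0
  cur :=
    { idx := 1
      start := 1
      Λ := I.lam • (1 : Matrix (Fin d) (Fin d) ℝ)
      b := 0
      Q := fun y _ => I.V₀ y
      prevPolicy := I.π₀ }
  past := []

/-- The data update of a round in which action `a` was played and the transition to `x'` was
observed: `Λ_{t+1} = Λ_t + φ_k(x_t, a) φ_k(x_t, a)ᵀ`, `b_{t+1} = b_t + V_k(x') φ_k(x_t, a)`. -/
def observe (ψ : X → A → X → Fin d → ℝ) (I : Inputs X A) (s : RunState X A d) (a : A) (x' : X) :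
    RunState X A d :=
  { s with
    t := s.t + 1
    x := x'
    Λ := s.Λ + Matrix.vecMulVec (s.cur.φ ψ I s.x a) (s.cur.φ ψ I s.x a)
    b := s.b + s.cur.V I x' • s.cur.φ ψ I s.x a }

/-- A reset to the state `y`: a new epoch starts with the data gathered so far. -/
def resetTo (M : MDP X A) (ψ : X → A → X → Fin d → ℝ) (I : Inputs X A) (s : RunState X A d)
    (y : X) : RunState X A d :=
  { s with
    x := y
    cur :=
      { idx := s.cur.idx + 1
        start := s.t
        Λ := s.Λ
        b := s.b
        Q := s.cur.nextQ M ψ I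
        prevPolicy := s.cur.policy I }
    past := s.cur :: s.past }

/-- One round: play `a ∼ π_k(· | x_t)`, observe `x' ∼ P(· | x_t, a)`, update the data, and with
probability `1 - γ` reset to a state drawn from `ν₀` and start a new epoch. -/
def step (M : MDP X A) (ψ : X → A → X → Fin d → ℝ) (I : Inputs X A) (s : RunState X A d) :
    PMF (RunState X A d) :=
  (s.cur.policy I s.x).bind fun a =>
    (M.P s.x a).bind fun x' =>
      M.resetCoin.bind fun reset =>
        if reset then M.ν₀.map (resetTo M ψ I (observe ψ I s a x'))
        else PMF.pure (observe ψ I s a x')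

/-- The law of the state of the interaction after `n` rounds, started from `x_1 ∼ ν₀`. -/
def run (M : MDP X A) (ψ : X → A → X → Fin d → ℝ) (I : Inputs X A) : ℕ → PMF (RunState X A d)
  | 0 => M.ν₀.map (initState I)
  | n + 1 => (run M ψ I n).bind (step M ψ I)

end Run

end RaviUCB

end

/-! Since `φ_k ⬝ᵥ θ = ∑ P V_k`, the bonus inequality says that ridge regression estimates `θ` well
in the direction `φ_k`. With `S = ∑ ε φ` the accumulated noise, `θ - θ̂ = λ Λ⁻¹ θ - Λ⁻¹ S`, so
Cauchy–Schwarz reduces everything to bounding `‖S‖_{Λ⁻¹}` at epoch starts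
(`abs_dotProduct_ridge_sub_le`).

For this, `potential` is a nonnegative supermartingale started at `1` (`sum_potential_le`). It is
the Gaussian mixture `∫ exp(⟨y, S/H⟩ - ½ ⟨y, (Λ - λI) y⟩) dN(0, (λI)⁻¹)(y)` in closed form.
Truncation keeps `V_k` in `[0, H]`, so the noise divided by `H` is sub-Gaussian by Hoeffding's
lemma.

Uniformity over epochs is a maximal inequality, proved without stopping times: `failBound` is `δ ·
potential` until some bonus fails and is frozen at `1` from then on. A bonus can fail only when `δ ·
potential ≥ 1`, so freezing never increases the value and the expectation of `failBound` stays at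
most `δ`. -/

noncomputable section

namespace RaviUCB

/-! ### Sub-Gaussian noise and one-dimensional Gaussian mixtures -/

section Analysis

open MeasureTheory ProbabilityTheory

/-- **Hoeffding's lemma** for a finitely supported law. -/
theorem sum_exp_mul_sub_mean_le {X : Type*} [Fintype X] (p : PMF X) (f : X → ℝ) {L : ℝ}
    (hf : ∀ x, 0 ≤ f x ∧ f x ≤ L) (u : ℝ) :
    ∑ x, (p x).toReal * Real.exp (u * (f x - ∑ y, (p y).toReal * f y)) ≤
      Real.exp (u ^ 2 * L ^ 2 / 2) := by
  let _ : MeasurableSpace X := ⊤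
  have h := (hasSubgaussianMGF_of_mem_Icc (μ := p.toMeasure) (X := f) (a := 0) (b := L)
    measurable_from_top.aemeasurable (ae_of_all _ fun x => hf x)).mgf_le u
  simp only [mgf, PMF.integral_eq_sum, smul_eq_mul] at h
  -- The sharp exponent is `u² L² / 8`; the cruder `u² L² / 2` already matches the factor `H` in
  -- `β`.
  refine h.trans (Real.exp_le_exp.2 ?_)
  push_cast
  rw [sub_zero, div_pow, Real.norm_eq_abs, sq_abs]
  nlinarith [mul_nonneg (sq_nonneg L) (sq_nonneg u)]

/-- Completing the square in `g`: the exponent is a parabola with peak at `√w (ε - z) / (1 + w)`. Up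
to normalization this averages `exp(u ε - u² / 2)` over `u ∼ N(z, w)`. -/
theorem integral_exp_mixture {w : ℝ} (hw : 0 ≤ w) (z ε : ℝ) :
    Integrable (fun g : ℝ => Real.exp ((z + √w * g) * ε - (z + √w * g) ^ 2 / 2) *
      Real.exp (-(1 / 2) * g ^ 2)) ∧
    ∫ g : ℝ, Real.exp ((z + √w * g) * ε - (z + √w * g) ^ 2 / 2) * Real.exp (-(1 / 2) * g ^ 2) =
      Real.exp ((-z ^ 2 + 2 * ε * z + ε ^ 2 * w) / (2 * (1 + w))) *
        √(Real.pi / ((1 + w) / 2)) := by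
  have hw1 : (1 + w) ≠ 0 := by positivity
  have key : ∀ g : ℝ, Real.exp ((z + √w * g) * ε - (z + √w * g) ^ 2 / 2) *
      Real.exp (-(1 / 2) * g ^ 2) =
      Real.exp ((-z ^ 2 + 2 * ε * z + ε ^ 2 * w) / (2 * (1 + w))) *
        Real.exp (-((1 + w) / 2) * (g - √w * (ε - z) / (1 + w)) ^ 2) := by
    intro g
    rw [← Real.exp_add, ← Real.exp_add]
    congr 1
    obtain ⟨s, rfl⟩ : ∃ s : ℝ, w = s ^ 2 := ⟨√w, (Real.sq_sqrt hw).symm⟩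
    have hs : √(s ^ 2) ^ 2 = s ^ 2 := Real.sq_sqrt hw
    generalize √(s ^ 2) = r at hs
    rw [← hs] at hw1 ⊢
    field_simp
    ring
  simp_rw [key]
  refine ⟨((integrable_exp_neg_mul_sq (by positivity)).comp_sub_right _).const_mul _, ?_⟩
  rw [integral_const_mul,
    integral_sub_right_eq_self (fun g : ℝ => Real.exp (-((1 + w) / 2) * g ^ 2)),
    integral_gaussian]

/-- Gaussian mixture of the sub-Gaussian supermartingale condition, in one dimension. -/
theorem sum_exp_quadratic_le {X : Type*} [Fintype X] (p : PMF X) (ε : X → ℝ)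
    (hε : ∀ u : ℝ, ∑ x, (p x).toReal * Real.exp (u * ε x) ≤ Real.exp (u ^ 2 / 2))
    {w : ℝ} (hw : 0 ≤ w) (z : ℝ) :
    ∑ x, (p x).toReal *
      Real.exp ((-z ^ 2 + 2 * ε x * z + (ε x) ^ 2 * w) / (2 * (1 + w))) ≤ √(1 + w) := by
  have hI := fun x => integral_exp_mixture hw z (ε x)
  have h1 : ∑ x, (p x).toReal *
      (Real.exp ((-z ^ 2 + 2 * ε x * z + (ε x) ^ 2 * w) / (2 * (1 + w))) *
        √(Real.pi / ((1 + w) / 2))) ≤ √(Real.pi / (1 / 2)) := by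
    simp_rw [← (hI _).2, ← integral_const_mul]
    rw [← integral_finsetSum _ fun x _ => (hI x).1.const_mul _, ← integral_gaussian]
    refine integral_mono (integrable_finsetSum _ fun x _ => (hI x).1.const_mul _)
      (integrable_exp_neg_mul_sq (by norm_num)) fun g => ?_
    have h2 := hε (z + √w * g)
    calc ∑ x, (p x).toReal * (Real.exp ((z + √w * g) * ε x - (z + √w * g) ^ 2 / 2) *
          Real.exp (-(1 / 2) * g ^ 2))
        = (∑ x, (p x).toReal * Real.exp ((z + √w * g) * ε x)) *
            Real.exp (-((z + √w * g) ^ 2 / 2)) * Real.exp (-(1 / 2) * g ^ 2) := by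
          rw [Finset.sum_mul, Finset.sum_mul]
          refine Finset.sum_congr rfl fun x _ => ?_
          rw [sub_eq_add_neg, Real.exp_add]
          ring
      _ ≤ Real.exp ((z + √w * g) ^ 2 / 2) *
            Real.exp (-((z + √w * g) ^ 2 / 2)) * Real.exp (-(1 / 2) * g ^ 2) := by gcongr
      _ = Real.exp (-(1 / 2) * g ^ 2) := by
          rw [← Real.exp_add, add_neg_cancel, Real.exp_zero, one_mul]
  simp_rw [← mul_assoc] at h1
  rw [← Finset.sum_mul] at h1
  -- The factor `√(1 + w)` is the ratio of the two Gaussian normalizations.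
  have h3 : √(Real.pi / (1 / 2)) = √(1 + w) * √(Real.pi / ((1 + w) / 2)) := by
    rw [← Real.sqrt_mul (by positivity)]
    congr 1
    field_simp
  rw [h3] at h1
  exact le_of_mul_le_mul_right h1 (Real.sqrt_pos.2 (by positivity))

end Analysis

/-! ### Rank-one updates, determinants and the norm of `Λ⁻¹` -/

section Matrices

open Matrix

variable {d : ℕ} {Λ : Matrix (Fin d) (Fin d) ℝ}

theorem dotProduct_mulVec_comm_of_isSymm (h : Λ.IsSymm) (u v : Fin d → ℝ) :
    u ⬝ᵥ Λ *ᵥ v = v ⬝ᵥ Λ *ᵥ u := by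
  rw [dotProduct_mulVec, ← mulVec_transpose, h.eq, dotProduct_comm]

theorem PosDef.isSymm (h : Λ.PosDef) : Λ.IsSymm := by
  simpa [IsHermitian, IsSymm] using h.isHermitian

theorem PosDef.dotProduct_inv_mulVec_nonneg (h : Λ.PosDef) (v : Fin d → ℝ) :
    0 ≤ v ⬝ᵥ Λ⁻¹ *ᵥ v := by
  simpa using h.inv.posSemidef.dotProduct_mulVec_nonneg v

/-- Sherman–Morrison, evaluated as a quadratic form. -/
theorem dotProduct_inv_add_vecMulVec (h : Λ.PosDef) (φ u v : Fin d → ℝ) :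
    u ⬝ᵥ (Λ + vecMulVec φ φ)⁻¹ *ᵥ v =
      u ⬝ᵥ Λ⁻¹ *ᵥ v - (φ ⬝ᵥ Λ⁻¹ *ᵥ u) * (φ ⬝ᵥ Λ⁻¹ *ᵥ v) / (1 + φ ⬝ᵥ Λ⁻¹ *ᵥ φ) := by
  have hw := PosDef.dotProduct_inv_mulVec_nonneg h φ
  set w := φ ⬝ᵥ Λ⁻¹ *ᵥ φ with hwdef
  have hdet : IsUnit Λ.det := (isUnit_iff_isUnit_det _).1 h.isUnit
  have hsym := PosDef.isSymm h.inv
  have hinv : (Λ + vecMulVec φ φ)⁻¹ =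
      Λ⁻¹ - (1 / (1 + w)) • vecMulVec (Λ⁻¹ *ᵥ φ) (Λ⁻¹ *ᵥ φ) := by
    refine inv_eq_right_inv ?_
    have h1 : Λ * vecMulVec (Λ⁻¹ *ᵥ φ) (Λ⁻¹ *ᵥ φ) = vecMulVec φ (Λ⁻¹ *ᵥ φ) := by
      rw [mul_vecMulVec, mulVec_mulVec, mul_nonsing_inv _ hdet, one_mulVec]
    have h2 : vecMulVec φ φ * Λ⁻¹ = vecMulVec φ (Λ⁻¹ *ᵥ φ) := by
      rw [vecMulVec_mul, ← mulVec_transpose, hsym.eq]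
    have h3 : vecMulVec φ φ * vecMulVec (Λ⁻¹ *ᵥ φ) (Λ⁻¹ *ᵥ φ) = w • vecMulVec φ (Λ⁻¹ *ᵥ φ) := by
      rw [vecMulVec_mul_vecMulVec, ← hwdef]
      ext i j
      simp [vecMulVec_apply]
      ring
    rw [mul_sub, add_mul, mul_nonsing_inv _ hdet, h2, mul_smul_comm, add_mul, h1, h3]
    have hw1 : (1 + w) ≠ 0 := by positivity
    ext i j
    simp [vecMulVec_apply]
    field_simp
    ring
  rw [hinv, sub_mulVec, dotProduct_sub, smul_mulVec, dotProduct_smul, vecMulVec_mulVec]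
  rw [dotProduct_mulVec_comm_of_isSymm hsym φ u, dotProduct_comm (Λ⁻¹ *ᵥ φ) v,
    dotProduct_mulVec_comm_of_isSymm hsym φ v]
  simp
  ring

theorem det_add_vecMulVec (h : Λ.PosDef) (φ : Fin d → ℝ) :
    (Λ + vecMulVec φ φ).det = Λ.det * (1 + φ ⬝ᵥ Λ⁻¹ *ᵥ φ) := by
  have hdet : IsUnit Λ.det := (isUnit_iff_isUnit_det _).1 h.isUnit
  rw [vecMulVec_eq Unit, det_add_replicateCol_mul_replicateRow hdet, dotProduct_mulVec]
  congr 2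
  simp [Matrix.mul_apply, dotProduct, vecMul, Finset.sum_mul]

/-- The determinant–trace inequality. -/
theorem log_det_le (h : Λ.PosDef) {m : ℝ} (hm : 0 < m) (htr : Λ.trace ≤ d * m) :
    Real.log Λ.det ≤ d * Real.log m := by
  have hev := h.eigenvalues_pos
  have htr' := h.isHermitian.trace_eq_sum_eigenvalues
  rw [h.isHermitian.det_eq_prod_eigenvalues]
  simp only [RCLike.ofReal_real_eq_id, id_eq] at htr' ⊢
  rw [Real.log_prod fun i _ => (hev i).ne']
  -- The logarithm lies below its tangent line at `m`.
  have h1 : ∀ i, Real.log (h.isHermitian.eigenvalues i) ≤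
      h.isHermitian.eigenvalues i / m - 1 + Real.log m := by
    intro i
    have := Real.log_le_sub_one_of_pos (div_pos (hev i) hm)
    rw [Real.log_div (hev i).ne' hm.ne'] at this
    linarith
  refine (Finset.sum_le_sum fun i _ => h1 i).trans ?_
  rw [Finset.sum_add_distrib, Finset.sum_sub_distrib, ← Finset.sum_div, ← htr']
  have : Λ.trace / m ≤ d := (div_le_iff₀ hm).2 htr
  simp
  linarith

/-- Cauchy–Schwarz for the form `Λ⁻¹`. -/
theorem abs_dotProduct_inv_mulVec_le (h : Λ.PosDef) (u v : Fin d → ℝ) :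
    |u ⬝ᵥ Λ⁻¹ *ᵥ v| ≤ matNorm Λ⁻¹ u * matNorm Λ⁻¹ v := by
  have hsym := dotProduct_mulVec_comm_of_isSymm (PosDef.isSymm h.inv) u v
  have hd : discrim (v ⬝ᵥ Λ⁻¹ *ᵥ v) (2 * (u ⬝ᵥ Λ⁻¹ *ᵥ v)) (u ⬝ᵥ Λ⁻¹ *ᵥ u) ≤ 0 := by
    refine discrim_le_zero fun c => ?_
    have := PosDef.dotProduct_inv_mulVec_nonneg h (u + c • v)
    simp only [mulVec_add, mulVec_smul, dotProduct_add, add_dotProduct, dotProduct_smul,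
      smul_dotProduct, smul_eq_mul, ← hsym] at this
    linarith
  unfold matNorm
  rw [← Real.sqrt_mul (PosDef.dotProduct_inv_mulVec_nonneg h u)]
  apply Real.abs_le_sqrt
  unfold discrim at hd
  linarith

theorem matNorm_inv_le {lam : ℝ} (hlam : 0 < lam) (h : Λ.PosDef)
    (hΛ : (Λ - lam • (1 : Matrix (Fin d) (Fin d) ℝ)).PosSemidef) (v : Fin d → ℝ) :
    matNorm Λ⁻¹ v ≤ l2norm v / √lam := by
  have hdet : IsUnit Λ.det := (isUnit_iff_isUnit_det _).1 h.isUnit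
  set y := Λ⁻¹ *ᵥ v with hy
  have hv : Λ *ᵥ y = v := by rw [hy, mulVec_mulVec, mul_nonsing_inv _ hdet, one_mulVec]
  have h1 : lam * (y ⬝ᵥ y) ≤ v ⬝ᵥ y := by
    have := hΛ.dotProduct_mulVec_nonneg y
    simp only [star_trivial, sub_mulVec, dotProduct_sub, smul_mulVec, one_mulVec,
      dotProduct_smul, smul_eq_mul, hv] at this
    rw [dotProduct_comm v]
    linarith
  have h2 : v ⬝ᵥ y ≤ l2norm v ^ 2 / lam := by
    have hn : l2norm v ^ 2 = v ⬝ᵥ v := by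
      rw [l2norm, EuclideanSpace.real_norm_sq_eq]
      simp [dotProduct, sq]
    -- Expanding this square and inserting `h1` gives `λ ⟨v, y⟩ ≤ ‖v‖²`.
    have h3 : 0 ≤ (v - lam • y) ⬝ᵥ (v - lam • y) := by
      simpa using dotProduct_self_star_nonneg (v - lam • y)
    simp only [sub_dotProduct, dotProduct_sub, smul_dotProduct, dotProduct_smul,
      smul_eq_mul, dotProduct_comm y v] at h3
    rw [le_div_iff₀ hlam, hn]
    nlinarith
  unfold matNorm
  refine Real.sqrt_le_iff.2 ⟨div_nonneg (norm_nonneg _) (Real.sqrt_nonneg _), ?_⟩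
  rwa [div_pow, Real.sq_sqrt hlam.le]

end Matrices

/-! ### Expectations under probability mass functions -/

section Expectation

/-- The expectation of a nonnegative function under a probability mass function. -/
def expect {α : Type*} (p : PMF α) (g : α → ℝ≥0∞) : ℝ≥0∞ := ∑' x, p x * g x

theorem expect_bind {α β : Type*} (p : PMF α) (f : α → PMF β) (g : β → ℝ≥0∞) :
    expect (p.bind f) g = expect p fun x => expect (f x) g := by
  simp only [expect, PMF.bind_apply, ← ENNReal.tsum_mul_left, ← ENNReal.tsum_mul_right]
  rw [ENNReal.tsum_comm]
  simp_rw [mul_assoc]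

theorem expect_pure {α : Type*} (x : α) (g : α → ℝ≥0∞) : expect (PMF.pure x) g = g x := by
  unfold expect
  rw [tsum_eq_single x]
  · simp
  · intro y hy
    simp [PMF.pure_apply, hy]

theorem expect_map {α β : Type*} (p : PMF α) (f : α → β) (g : β → ℝ≥0∞) :
    expect (p.map f) g = expect p fun x => g (f x) := by
  rw [← PMF.bind_pure_comp, expect_bind]
  simp [expect_pure]

theorem expect_mono {α : Type*} (p : PMF α) {g h : α → ℝ≥0∞}
    (hgh : ∀ x ∈ p.support, g x ≤ h x) : expect p g ≤ expect p h := by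
  refine ENNReal.tsum_le_tsum fun x => ?_
  by_cases hx : p x = 0
  · simp [hx]
  · gcongr
    exact hgh x hx

theorem expect_le_of_le {α : Type*} (p : PMF α) {g : α → ℝ≥0∞} {c : ℝ≥0∞}
    (h : ∀ x, g x ≤ c) : expect p g ≤ c := by
  refine (expect_mono p fun x _ => h x).trans ?_
  simp [expect, ENNReal.tsum_mul_right, p.tsum_coe]

theorem expect_ofReal {α : Type*} [Fintype α] (p : PMF α) {g : α → ℝ} (hg : ∀ x, 0 ≤ g x) :
    (expect p fun x => ENNReal.ofReal (g x)) = ENNReal.ofReal (∑ x, (p x).toReal * g x) := by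
  rw [expect, tsum_fintype, ENNReal.ofReal_sum_of_nonneg fun x _ =>
    mul_nonneg ENNReal.toReal_nonneg (hg x)]
  refine Finset.sum_congr rfl fun x _ => ?_
  rw [ENNReal.ofReal_mul ENNReal.toReal_nonneg, ENNReal.ofReal_toReal (p.apply_ne_top x)]

/-- Markov's inequality at level `1`; it turns the bound on the expected `failBound` into one on the
probability of failure. -/
theorem toMeasure_le_expect {α : Type*} [MeasurableSpace α] (p : PMF α) {s : Set α}
    (hs : MeasurableSet s) {g : α → ℝ≥0∞} (h : ∀ x ∈ s, 1 ≤ g x) : p.toMeasure s ≤ expect p g := by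
  rw [p.toMeasure_apply hs]
  refine ENNReal.tsum_le_tsum fun x => ?_
  by_cases hx : x ∈ s
  · simpa [hx] using mul_le_mul_right (h x hx) (p x)
  · simp [hx]

end Expectation

/-! ### The mixture supermartingale and the confidence ellipsoid -/

section Potential

open Matrix

variable {d : ℕ}

/-- The deviation `b - (Λ - λ I) θ` of the regression data from its conditional mean. -/
def residual (lam : ℝ) (θ : Fin d → ℝ) (Λ : Matrix (Fin d) (Fin d) ℝ) (b : Fin d → ℝ) :
    Fin d → ℝ :=
  b - (Λ - lam • (1 : Matrix (Fin d) (Fin d) ℝ)) *ᵥ θ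

/-- The method-of-mixtures supermartingale `√(det (λ I) / det Λ) exp (‖S‖²_{Λ⁻¹} / (2 H²))`. -/
def potential (H lam : ℝ) (θ : Fin d → ℝ) (Λ : Matrix (Fin d) (Fin d) ℝ) (b : Fin d → ℝ) : ℝ :=
  Real.exp ((residual lam θ Λ b ⬝ᵥ Λ⁻¹ *ᵥ residual lam θ Λ b) / (2 * H ^ 2) -
    (Real.log Λ.det - d * Real.log lam) / 2)

theorem residual_update (lam : ℝ) (θ : Fin d → ℝ) (Λ : Matrix (Fin d) (Fin d) ℝ)
    (b φ : Fin d → ℝ) (v : ℝ) :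
    residual lam θ (Λ + vecMulVec φ φ) (b + v • φ) =
      residual lam θ Λ b + (v - φ ⬝ᵥ θ) • φ := by
  unfold residual
  rw [add_sub_right_comm Λ, add_mulVec, vecMulVec_mulVec]
  ext i
  simp
  ring

/-- Under the tilted law `N(Λ⁻¹ S / H, Λ⁻¹)` of the mixture variable `y`, the coordinate `u = ⟨y,
φ⟩` is `N(z / H, w)`, and a new observation only involves `u`. So the one-dimensional bound
suffices: its loss `√(1 + w)` is cancelled by the growth of the determinant. -/
theorem sum_potential_le {X : Type*} [Fintype X] (p : PMF X) {V : X → ℝ} {H : ℝ} (hH : 0 < H)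
    (hV : ∀ x, 0 ≤ V x ∧ V x ≤ H) (lam : ℝ) (θ φ b : Fin d → ℝ)
    {Λ : Matrix (Fin d) (Fin d) ℝ} (hΛ : Λ.PosDef)
    (hmean : ∑ x, (p x).toReal * V x = φ ⬝ᵥ θ) :
    ∑ x, (p x).toReal * potential H lam θ (Λ + vecMulVec φ φ) (b + V x • φ) ≤
      potential H lam θ Λ b := by
  set S := residual lam θ Λ b with hS
  set w := φ ⬝ᵥ Λ⁻¹ *ᵥ φ with hwdef
  set z := φ ⬝ᵥ Λ⁻¹ *ᵥ S with hz
  have hw : 0 ≤ w := PosDef.dotProduct_inv_mulVec_nonneg hΛ φ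
  have hw1 : 0 < 1 + w := by positivity
  have hsg : ∀ u : ℝ, ∑ x, (p x).toReal * Real.exp (u * ((V x - φ ⬝ᵥ θ) / H)) ≤
      Real.exp (u ^ 2 / 2) := by
    intro u
    have := sum_exp_mul_sub_mean_le p V hV (u / H)
    rw [hmean, div_pow, div_mul_cancel₀ _ (by positivity)] at this
    simpa only [div_mul_eq_mul_div, mul_div_assoc] using this
  have hmix := sum_exp_quadratic_le p _ hsg hw (z / H)
  have key : ∀ x, potential H lam θ (Λ + vecMulVec φ φ) (b + V x • φ) =
      Real.exp ((-(z / H) ^ 2 + 2 * ((V x - φ ⬝ᵥ θ) / H) * (z / H) +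
        ((V x - φ ⬝ᵥ θ) / H) ^ 2 * w) / (2 * (1 + w))) *
        (potential H lam θ Λ b * (√(1 + w))⁻¹) := by
    intro x
    have hsq : (√(1 + w))⁻¹ = Real.exp (-(Real.log (1 + w) / 2)) := by
      rw [Real.exp_neg, ← Real.log_sqrt hw1.le, Real.exp_log (Real.sqrt_pos.2 hw1)]
    rw [hsq]
    unfold potential
    rw [residual_update, ← hS, det_add_vecMulVec hΛ, ← hwdef, Real.log_mul hΛ.det_pos.ne' hw1.ne',
      ← Real.exp_add, ← Real.exp_add]
    congr 1
    set ε := V x - φ ⬝ᵥ θ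
    -- By Sherman–Morrison, the quadratic form changes by exactly the exponent of the
    -- one-dimensional mixture.
    have hq : (S + ε • φ) ⬝ᵥ (Λ + vecMulVec φ φ)⁻¹ *ᵥ (S + ε • φ) =
        S ⬝ᵥ Λ⁻¹ *ᵥ S + (-z ^ 2 + 2 * ε * z + ε ^ 2 * w) / (1 + w) := by
      rw [dotProduct_inv_add_vecMulVec hΛ, ← hwdef]
      simp only [mulVec_add, mulVec_smul, dotProduct_add, add_dotProduct, dotProduct_smul,
        smul_dotProduct, smul_eq_mul, ← hwdef, ← hz,
        dotProduct_mulVec_comm_of_isSymm (PosDef.isSymm hΛ.inv) S φ]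
      field_simp
      ring
    rw [hq]
    field_simp
    ring
  simp_rw [key, ← mul_assoc]
  rw [← Finset.sum_mul, ← Finset.sum_mul]
  calc _ ≤ √(1 + w) * potential H lam θ Λ b * (√(1 + w))⁻¹ := by
        have : 0 ≤ potential H lam θ Λ b := (Real.exp_pos _).le
        gcongr
    _ = potential H lam θ Λ b := by
        have := (Real.sqrt_pos.2 hw1).ne'
        field_simp

/-- The confidence ellipsoid: if the potential has not exceeded `1 / δ`, then the ridge regression
estimate is close to `θ` in every direction. -/
theorem abs_dotProduct_ridge_sub_le {H lam δ m B : ℝ} (hH : 0 < H) (hlam : 0 < lam) (hδ : 0 < δ)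
    (hm : 0 < m) {θ b : Fin d → ℝ} (hθ : l2norm θ ≤ B) {Λ : Matrix (Fin d) (Fin d) ℝ}
    (hΛ : Λ.PosDef) (hge : (Λ - lam • (1 : Matrix (Fin d) (Fin d) ℝ)).PosSemidef)
    (htr : Λ.trace ≤ d * m) (hpot : δ * potential H lam θ Λ b ≤ 1) (φ : Fin d → ℝ) :
    |φ ⬝ᵥ (θ - Λ⁻¹ *ᵥ b)| ≤
      (H * √(2 * ((d : ℝ) / 2 * Real.log (m / lam) + Real.log (1 / δ))) + √lam * B) *
        matNorm Λ⁻¹ φ := by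
  have hdet : IsUnit Λ.det := (isUnit_iff_isUnit_det _).1 hΛ.isUnit
  set S := residual lam θ Λ b with hS
  have hdecomp : θ - Λ⁻¹ *ᵥ b = lam • Λ⁻¹ *ᵥ θ - Λ⁻¹ *ᵥ S := by
    have hb : b = S + Λ *ᵥ θ - lam • θ := by
      rw [hS, residual, sub_mulVec, smul_mulVec, one_mulVec]
      abel
    have h1 : Λ⁻¹ *ᵥ b = Λ⁻¹ *ᵥ S + θ - lam • Λ⁻¹ *ᵥ θ := by
      conv_lhs => rw [hb]
      rw [mulVec_sub, mulVec_add, mulVec_mulVec, nonsing_inv_mul _ hdet, one_mulVec, mulVec_smul]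
    rw [h1]
    abel
  have hSn : matNorm Λ⁻¹ S ≤
      H * √(2 * ((d : ℝ) / 2 * Real.log (m / lam) + Real.log (1 / δ))) := by
    have h1 : potential H lam θ Λ b ≤ Real.exp (Real.log (1 / δ)) := by
      rw [Real.exp_log (by positivity), le_div_iff₀ hδ]
      linarith
    have h2 := Real.exp_le_exp.1 h1
    rw [← hS] at h2
    have h3 := log_det_le hΛ hm htr
    unfold matNorm
    nth_rewrite 1 [← Real.sqrt_sq hH.le]
    rw [← Real.sqrt_mul (sq_nonneg H)]
    apply Real.sqrt_le_sqrt
    rw [Real.log_div hm.ne' hlam.ne']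
    have h4 : (S ⬝ᵥ Λ⁻¹ *ᵥ S) / (2 * H ^ 2) ≤
        (d : ℝ) / 2 * (Real.log m - Real.log lam) + Real.log (1 / δ) := by linarith
    rw [div_le_iff₀ (by positivity)] at h4
    linarith
  have hφ : 0 ≤ matNorm Λ⁻¹ φ := Real.sqrt_nonneg _
  have hθn : lam * matNorm Λ⁻¹ θ ≤ √lam * B := by
    have h1 := matNorm_inv_le hlam hΛ hge θ
    have h2 : 0 < √lam := Real.sqrt_pos.2 hlam
    calc lam * matNorm Λ⁻¹ θ ≤ lam * (B / √lam) := by gcongr; exact h1.trans (by gcongr)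
      _ = √lam * B := by
        nth_rewrite 1 [← Real.mul_self_sqrt hlam.le]
        field_simp
  have e1 := abs_dotProduct_inv_mulVec_le hΛ φ θ
  have e2 := abs_dotProduct_inv_mulVec_le hΛ φ S
  rw [hdecomp, dotProduct_sub, dotProduct_smul, smul_eq_mul]
  calc |lam * (φ ⬝ᵥ Λ⁻¹ *ᵥ θ) - φ ⬝ᵥ Λ⁻¹ *ᵥ S|
      ≤ |lam * (φ ⬝ᵥ Λ⁻¹ *ᵥ θ)| + |φ ⬝ᵥ Λ⁻¹ *ᵥ S| := abs_sub _ _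
    _ ≤ lam * (matNorm Λ⁻¹ φ * matNorm Λ⁻¹ θ) + matNorm Λ⁻¹ φ * matNorm Λ⁻¹ S := by
        rw [abs_mul, abs_of_pos hlam]
        gcongr
    _ = (matNorm Λ⁻¹ S + lam * matNorm Λ⁻¹ θ) * matNorm Λ⁻¹ φ := by ring
    _ ≤ _ := by gcongr

end Potential

/-! ### Invariants of a run, and validity from a small potential -/

section Invariant

open Matrix

variable {X A : Type*} {d : ℕ}

theorem MDP.H_pos (M : MDP X A) : 0 < M.H :=
  one_div_pos.2 (by linarith [M.γ_lt_one])

theorem softValue_mem [Fintype A] {η H : ℝ} (hη : 0 < η) (π : PMF A) {q : A → ℝ}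
    (hq : ∀ a, 0 ≤ q a ∧ q a ≤ H) : 0 ≤ softValue η π q ∧ softValue η π q ≤ H := by
  have hπ := sum_toReal_pmf π
  have h0 : 1 ≤ ∑ a, (π a).toReal * Real.exp (η * q a) := by
    rw [← hπ]
    refine Finset.sum_le_sum fun a _ => le_mul_of_one_le_right ENNReal.toReal_nonneg ?_
    exact Real.one_le_exp (mul_nonneg hη.le (hq a).1)
  have h1 : ∑ a, (π a).toReal * Real.exp (η * q a) ≤ Real.exp (η * H) := by
    rw [← one_mul (Real.exp (η * H)), ← hπ, Finset.sum_mul]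
    refine Finset.sum_le_sum fun a _ => ?_
    have := (hq a).2
    gcongr
  unfold softValue
  refine ⟨mul_nonneg (by positivity) (Real.log_nonneg h0), ?_⟩
  have h2 := Real.log_le_log (by linarith) h1
  rw [Real.log_exp] at h2
  rw [one_div, inv_mul_le_iff₀ hη]
  exact h2

theorem trunc_mem {m : ℝ} (hm : 0 ≤ m) (y : ℝ) : 0 ≤ trunc m y ∧ trunc m y ≤ m :=
  ⟨le_max_right _ _, max_le (min_le_right _ _) hm⟩

theorem feature_dotProduct [Fintype X] (ψ : X → A → X → Fin d → ℝ) (V : X → ℝ) (x : X) (a : A)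
    (θ : Fin d → ℝ) :
    feature ψ V x a ⬝ᵥ θ = ∑ x', (∑ i, θ i * ψ x a x' i) * V x' := by
  rw [feature, sum_dotProduct]
  refine Finset.sum_congr rfl fun x' _ => ?_
  rw [smul_dotProduct, smul_eq_mul, mul_comm, dotProduct_comm]
  rfl

/-- What holds along every run of the algorithm. -/
structure Inv (M : MDP X A) (I : Inputs X A) (B : ℝ) (s : RunState X A d) : Prop where
  posSemidef : (s.Λ - I.lam • (1 : Matrix (Fin d) (Fin d) ℝ)).PosSemidef
  trace_le : s.Λ.trace ≤ d * I.lam + ((s.t : ℝ) - 1) * (B * M.H) ^ 2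
  Q_mem : ∀ x a, 0 ≤ s.cur.Q x a ∧ s.cur.Q x a ≤ M.H

variable {M : MDP X A} {ψ : X → A → X → Fin d → ℝ} {I : Inputs X A} {B : ℝ}
  {s : RunState X A d}

theorem Inv.posDef (h : Inv M I B s) : s.Λ.PosDef := by
  have := (PosDef.one (n := Fin d) (R := ℝ)).smul I.lam_pos |>.add_posSemidef h.posSemidef
  simpa using this

theorem Inv.initState (hV₀ : ∀ x, 0 ≤ I.V₀ x ∧ I.V₀ x ≤ M.H) (x : X) :
    Inv M I B (initState I x : RunState X A d) where
  posSemidef := by simpa [RaviUCB.initState] using PosSemidef.zero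
  trace_le := by simp [RaviUCB.initState, mul_comm]
  Q_mem y _ := hV₀ y

variable [Fintype A]

theorem Inv.V_mem (h : Inv M I B s) (x : X) : 0 ≤ s.cur.V I x ∧ s.cur.V I x ≤ M.H :=
  softValue_mem I.η_pos _ (h.Q_mem x)

variable [Fintype X]

theorem Inv.observe (hM : IsLinearMixture M ψ B) (h : Inv M I B s) (a : A) (x' : X) :
    Inv M I B (observe ψ I s a x') where
  posSemidef := by
    have := h.posSemidef.add (posSemidef_vecMulVec_self_star (s.cur.φ ψ I s.x a))
    rw [star_trivial] at this
    simpa [RaviUCB.observe, add_sub_right_comm] using this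
  trace_le := by
    have h1 : s.cur.φ ψ I s.x a ⬝ᵥ s.cur.φ ψ I s.x a ≤ (B * M.H) ^ 2 := by
      have h2 := hM.2 s.x a _ h.V_mem
      have h3 : l2norm (feature ψ (s.cur.V I) s.x a) ^ 2 =
          s.cur.φ ψ I s.x a ⬝ᵥ s.cur.φ ψ I s.x a := by
        rw [l2norm, EuclideanSpace.real_norm_sq_eq]
        simp [dotProduct, sq, Epoch.φ]
      rw [← h3]
      exact pow_le_pow_left₀ (norm_nonneg _) h2 2
    have := h.trace_le
    simp only [RaviUCB.observe, trace_add, trace_vecMulVec]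
    push_cast
    linarith
  Q_mem := h.Q_mem

theorem Inv.resetTo (h : Inv M I B s) (y : X) : Inv M I B (resetTo M ψ I s y) where
  posSemidef := h.posSemidef
  trace_le := h.trace_le
  Q_mem _ _ := trunc_mem M.H_pos.le _

theorem Inv.of_mem_support_step (hM : IsLinearMixture M ψ B) (h : Inv M I B s)
    {s' : RunState X A d} (hs' : s' ∈ (step M ψ I s).support) : Inv M I B s' := by
  simp only [step, PMF.mem_support_bind_iff] at hs'
  obtain ⟨a, -, x', -, c, -, hc⟩ := hs'
  cases c
  · rw [if_neg (by simp), PMF.support_pure, Set.mem_singleton_iff] at hc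
    exact hc ▸ h.observe hM a x'
  · rw [if_pos rfl, PMF.support_map] at hc
    obtain ⟨y, -, rfl⟩ := hc
    exact (h.observe hM a x').resetTo y

theorem Inv.of_mem_support_run (hM : IsLinearMixture M ψ B)
    (hV₀ : ∀ x, 0 ≤ I.V₀ x ∧ I.V₀ x ≤ M.H) (n : ℕ) :
    ∀ s ∈ (run M ψ I n).support, Inv M I B s := by
  induction n with
  | zero =>
    intro s hs
    rw [run, PMF.support_map] at hs
    obtain ⟨x, -, rfl⟩ := hs
    exact Inv.initState hV₀ x
  | succ n ih =>
    intro s hs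
    rw [run, PMF.mem_support_bind_iff] at hs
    obtain ⟨s₀, h₀, h₁⟩ := hs
    exact (ih s₀ h₀).of_mem_support_step hM h₁

/-- The value of `β` prescribed by the confidence bound. -/
def confidenceRadius (d : ℕ) (H lam B δ : ℝ) (T : ℕ) : ℝ :=
  H * √(2 * ((d : ℝ) / 2 * Real.log (1 + (T : ℝ) * B ^ 2 * H ^ 2 / (lam * (d : ℝ))) +
    Real.log (1 / δ))) + √lam * B

/-- The confidence ellipsoid bounds the error in every direction at once, so it applies to `φ_k`
although `V_k` depends on the data; no covering of value functions is needed. -/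
theorem Inv.valid_of_potential_le (h : Inv M I B s) {θ : Fin d → ℝ} (hθ : l2norm θ ≤ B)
    (hP : ∀ x a x', (M.P x a x').toReal = ∑ i, θ i * ψ x a x' i) {T : ℕ} (hT : s.t ≤ T)
    {δ : ℝ} (hδ : 0 < δ) (hβ : I.β = confidenceRadius d M.H I.lam B δ T)
    (hpot : δ * potential M.H I.lam θ s.Λ s.b ≤ 1) (e : Epoch X A d) (heΛ : e.Λ = s.Λ)
    (heb : e.b = s.b) : e.Valid M ψ I := by
  intro x a
  have hlam := I.lam_pos
  -- The trace invariant divided by `d`, a bound on the mean eigenvalue. For `d = 0` the quotient is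
  -- `0` by convention, and the trace vanishes.
  have hm : 0 < I.lam + T * (B * M.H) ^ 2 / d := by positivity
  have htr : s.Λ.trace ≤ d * (I.lam + T * (B * M.H) ^ 2 / d) := by
    rcases Nat.eq_zero_or_pos d with rfl | hd
    · simp [Matrix.trace]
    · have hd' : (0 : ℝ) < d := by exact_mod_cast hd
      rw [mul_add, mul_div_cancel₀ _ hd'.ne']
      refine h.trace_le.trans ?_
      have : (s.t : ℝ) ≤ T := by exact_mod_cast hT
      gcongr
      linarith
  have hlog : (I.lam + T * (B * M.H) ^ 2 / d) / I.lam =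
      1 + (T : ℝ) * B ^ 2 * M.H ^ 2 / (I.lam * (d : ℝ)) := by
    rw [add_div, div_self hlam.ne', div_div, mul_pow, mul_comm (d : ℝ), ← mul_assoc]
  have hmain := abs_dotProduct_ridge_sub_le M.H_pos hlam hδ hm hθ h.posDef h.posSemidef htr hpot
    (e.φ ψ I x a)
  rw [hlog, ← heΛ, ← heb] at hmain
  have heq : ∑ x', (M.γ * (M.P x a x').toReal - M.γ * e.PHat ψ x a x') * e.V I x' =
      M.γ * (e.φ ψ I x a ⬝ᵥ (θ - e.Λ⁻¹ *ᵥ e.b)) := by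
    rw [dotProduct_sub, Epoch.φ, feature_dotProduct, feature_dotProduct, ← Finset.sum_sub_distrib,
      Finset.mul_sum]
    refine Finset.sum_congr rfl fun x' _ => ?_
    rw [hP]
    simp only [Epoch.PHat, Epoch.thetaHat]
    ring
  rw [heq, abs_mul, abs_of_pos M.γ_pos, Epoch.CB, hβ]
  -- The factor `γ ≤ 1` is simply dropped.
  exact (mul_le_of_le_one_left (abs_nonneg _) M.γ_lt_one.le).trans hmain

end Invariant

/-! ### The maximal inequality along the run -/

section Failure

open Matrix

variable {X A : Type*} [Fintype X] [Fintype A] {d : ℕ}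

/-- The bonuses of all epochs started up to time `T` are valid. -/
def AllValid (M : MDP X A) (ψ : X → A → X → Fin d → ℝ) (I : Inputs X A) (T : ℕ)
    (s : RunState X A d) : Prop :=
  ∀ e ∈ s.epochs, e.start ≤ T → e.Valid M ψ I

open Classical in
/-- An upper bound of the conditional probability of failure. -/
def failBound (M : MDP X A) (ψ : X → A → X → Fin d → ℝ) (I : Inputs X A) (T : ℕ) (δ : ℝ)
    (θ : Fin d → ℝ) (s : RunState X A d) : ℝ≥0∞ :=
  if AllValid M ψ I T s then ENNReal.ofReal (δ * potential M.H I.lam θ s.Λ s.b) else 1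

variable {M : MDP X A} {ψ : X → A → X → Fin d → ℝ} {I : Inputs X A} {B : ℝ} {T : ℕ} {δ : ℝ}
  {θ : Fin d → ℝ} {s : RunState X A d}

/-- A reset leaves `Λ` and `b` unchanged, so the value can change only if the new epoch is the first
invalid one; then `δ · potential` was already at least `1`. -/
theorem failBound_resetTo_le (h : Inv M I B s) (hθ : l2norm θ ≤ B)
    (hP : ∀ x a x', (M.P x a x').toReal = ∑ i, θ i * ψ x a x' i) (hδ : 0 < δ)
    (hβ : I.β = confidenceRadius d M.H I.lam B δ T) (y : X) :
    failBound M ψ I T δ θ (resetTo M ψ I s y) ≤ failBound M ψ I T δ θ s := by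
  by_cases hs : AllValid M ψ I T s
  · by_cases hr : AllValid M ψ I T (resetTo M ψ I s y)
    · rw [failBound, failBound, if_pos hs, if_pos hr]
      rfl
    · rw [failBound, failBound, if_pos hs, if_neg hr]
      by_contra! hlt
      rw [ENNReal.ofReal_lt_one] at hlt
      refine hr fun e he heT => ?_
      rcases List.mem_cons.1 he with rfl | he
      -- The new epoch starts at the current time, so `heT` is the bound `s.t ≤ T` on the amount of
      -- data.
      · exact h.valid_of_potential_le hθ hP heT hδ hβ hlt.le _ rfl rfl
      · exact hs e he heT
  · have hr : ¬ AllValid M ψ I T (resetTo M ψ I s y) := fun hr =>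
      hs fun e he => hr e (List.mem_cons_of_mem _ he)
    rw [failBound, failBound, if_neg hs, if_neg hr]

theorem expect_failBound_observe_le (h : Inv M I B s)
    (hP : ∀ x a x', (M.P x a x').toReal = ∑ i, θ i * ψ x a x' i) (hδ : 0 < δ) (a : A) :
    (expect (M.P s.x a) fun x' => failBound M ψ I T δ θ (observe ψ I s a x')) ≤
      failBound M ψ I T δ θ s := by
  by_cases hs : AllValid M ψ I T s
  · have ho : ∀ x', AllValid M ψ I T (observe ψ I s a x') := fun _ => hs
    simp only [failBound, if_pos hs, if_pos (ho _)]
    rw [expect_ofReal]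
    swap
    · exact fun x => mul_nonneg hδ.le (Real.exp_pos _).le
    refine ENNReal.ofReal_le_ofReal ?_
    simp_rw [mul_left_comm _ δ]
    rw [← Finset.mul_sum]
    refine mul_le_mul_of_nonneg_left ?_ hδ.le
    refine sum_potential_le _ M.H_pos h.V_mem _ _ _ _ h.posDef ?_
    rw [Epoch.φ, feature_dotProduct]
    simp_rw [hP]
  · have ho : ∀ x', ¬ AllValid M ψ I T (observe ψ I s a x') := fun _ => hs
    simp only [failBound, if_neg hs, if_neg (ho _)]
    exact expect_le_of_le _ fun _ => le_rfl

theorem expect_failBound_step_le (hM : IsLinearMixture M ψ B) (h : Inv M I B s)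
    (hθ : l2norm θ ≤ B) (hP : ∀ x a x', (M.P x a x').toReal = ∑ i, θ i * ψ x a x' i)
    (hδ : 0 < δ) (hβ : I.β = confidenceRadius d M.H I.lam B δ T) :
    expect (step M ψ I s) (failBound M ψ I T δ θ) ≤ failBound M ψ I T δ θ s := by
  rw [step, expect_bind]
  -- The bound holds for each action separately, so the policy plays no role.
  refine expect_le_of_le _ fun a => ?_
  rw [expect_bind]
  refine (expect_mono _ fun x' _ => ?_).trans (expect_failBound_observe_le h hP hδ a)
  rw [expect_bind]
  refine expect_le_of_le _ fun c => ?_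
  cases c
  · rw [if_neg (by simp), expect_pure]
  · rw [if_pos rfl, expect_map]
    exact expect_le_of_le _ fun y =>
      failBound_resetTo_le (h.observe hM a x') hθ hP hδ hβ y

theorem failBound_initState_le (hV₀ : ∀ x, 0 ≤ I.V₀ x ∧ I.V₀ x ≤ M.H) (hθ : l2norm θ ≤ B)
    (hP : ∀ x a x', (M.P x a x').toReal = ∑ i, θ i * ψ x a x' i) (hδ : 0 < δ) (hδ1 : δ ≤ 1)
    (hβ : I.β = confidenceRadius d M.H I.lam B δ T) (x : X) :
    failBound M ψ I T δ θ (initState I x) ≤ ENNReal.ofReal δ := by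
  have hinv : Inv M I B (initState I x : RunState X A d) := Inv.initState hV₀ x
  have hpot : potential M.H I.lam θ (initState I x : RunState X A d).Λ
      (initState I x : RunState X A d).b = 1 := by
    -- No noise has accumulated, and `log det (λ I) = d log λ`.
    simp [potential, residual, initState, Real.log_pow]
  have hv : AllValid M ψ I T (initState I x) := by
    intro e he heT
    rw [RunState.epochs, List.mem_cons] at he
    rcases he with rfl | he
    · exact hinv.valid_of_potential_le hθ hP heT hδ hβ (by rwa [hpot, mul_one]) _ rfl rfl
    · simp [initState] at he
  rw [failBound, if_pos hv, hpot, mul_one]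

theorem expect_failBound_run_le (hM : IsLinearMixture M ψ B)
    (hV₀ : ∀ x, 0 ≤ I.V₀ x ∧ I.V₀ x ≤ M.H) (hθ : l2norm θ ≤ B)
    (hP : ∀ x a x', (M.P x a x').toReal = ∑ i, θ i * ψ x a x' i) (hδ : 0 < δ) (hδ1 : δ ≤ 1)
    (hβ : I.β = confidenceRadius d M.H I.lam B δ T) (n : ℕ) :
    expect (run M ψ I n) (failBound M ψ I T δ θ) ≤ ENNReal.ofReal δ := by
  induction n with
  | zero =>
    rw [run, expect_map]
    exact expect_le_of_le _ fun x => failBound_initState_le hV₀ hθ hP hδ hδ1 hβ x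
  | succ n ih =>
    rw [run, expect_bind]
    exact (expect_mono _ fun s hs => expect_failBound_step_le hM
      (Inv.of_mem_support_run hM hV₀ n s hs) hθ hP hδ hβ).trans ih

end Failure

end RaviUCB

end

theorem mainTheorem5 {X A : Type*} [Fintype X] [Fintype A] {d : ℕ}
    (M : RaviUCB.MDP X A) (ψ : X → A → X → Fin d → ℝ) (B : ℝ)
    (hM : RaviUCB.IsLinearMixture M ψ B)
    (I : RaviUCB.Inputs X A) (hV₀ : ∀ x, 0 ≤ I.V₀ x ∧ I.V₀ x ≤ M.H)
    (T : ℕ) (δ : ℝ) (hδ0 : 0 < δ) (hδ1 : δ < 1)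
    (hβ : I.β = M.H * Real.sqrt (2 * ((d : ℝ) / 2 *
        Real.log (1 + (T : ℝ) * B ^ 2 * M.H ^ 2 / (I.lam * (d : ℝ))) + Real.log (1 / δ)))
      + Real.sqrt I.lam * B) :
    ENNReal.ofReal (1 - δ) ≤
      (RaviUCB.run M ψ I T).toMeasure
        {s | ∀ e ∈ s.epochs, e.start ≤ T → e.Valid M ψ I} := by
  obtain ⟨θ, hθ, hP⟩ := hM.1
  -- After `T` rounds the clock shows `T + 1`, and a last reset may have opened an epoch at that
  -- time; `e.start ≤ T` excludes it.
  set G : Set (RaviUCB.RunState X A d) := {s | ∀ e ∈ s.epochs, e.start ≤ T → e.Valid M ψ I}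
  have hG : MeasurableSet G := MeasurableSpace.measurableSet_top
  have hfail : (RaviUCB.run M ψ I T).toMeasure Gᶜ ≤ ENNReal.ofReal δ := by
    refine (RaviUCB.toMeasure_le_expect _ hG.compl fun s hs => ?_).trans
      (RaviUCB.expect_failBound_run_le hM hV₀ hθ hP hδ0 hδ1.le hβ T)
    have hs' : ¬ RaviUCB.AllValid M ψ I T s := hs
    rw [RaviUCB.failBound, if_neg hs']
  rw [ENNReal.ofReal_sub _ hδ0.le, ENNReal.ofReal_one, tsub_le_iff_right]
  calc 1 = (RaviUCB.run M ψ I T).toMeasure G + (RaviUCB.run M ψ I T).toMeasure Gᶜ := by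
        rw [MeasureTheory.measure_add_measure_compl hG, MeasureTheory.measure_univ]
    _ ≤ _ := by gcongr
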